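/- A box with $n\ge 1$ inputs $x_1,\dots,x_n$ for Alice and two inputs $y,y'$ for Bob is a family of probability distributions $P=\{p(a,b|x,y)\}$ on finite sets of outcomes; $|z|$ denotes the number of outcomes of the input $z$. A box is non-signalling if $\sum_a p(a,b|x,y)$ does not depend on $x$ and $\sum_b p(a,b|x,y)$ does not depend on $y$. It is deterministic if $a$ is a function of $x$ and $b$ is a function of $y$. It is quantum if $p(a,b|x,y)=\mathrm{tr}\big((M^x_a\otimes N^y_b)\rho\big)$ for POVMs $\{M^x_a\}_a$ on $\mathbb C^{d_A}$, POVMs $\{N^y_b\}_b$ on $\mathbb C^{d_B}$ and a density matrix $\rho$ on $\mathbb C^{d_A}\otimes\mathbb C^{d_B}$, for some $d_A,d_B$. The fraction of determinism $\mathrm{FOD}(P)$ is the largest $c\in[0,1]$ such that $P=(1-c)X+cD$ for some non-signalling box $X$ and some deterministic box $D$. **Theorem.** Let $P$ be a quantum box with $n\ge 1$ inputs $x_1,\dots,x_n$ for Alice and two inputs $y,y'$ for Bob. Put $k=\max\{|x_1|,\dots,|x_n|\}$, $l_1=|y|$, $l_2=|y'|$, $l=\max\{l_1,l_2\}$ and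 $c_0=\dfrac{0.1134}{2\,k\,l\,l_1\,l_2}$. Then the maximum defining $\mathrm{FOD}(P)$ is attained and $$\mathrm{FOD}(P)\ \ge\ c_0 .$$ Consequently, for every linear function $\beta(P)=\sum_{x,y,a,b}s^{a,b}_{x,y}\,p(a,b|x,y)$ with real coefficients, $$\beta(P)\ \le\ \beta_{alg}^{\max}-c_0\,\big(\beta_{alg}^{\max}-\beta_{det}^{\max}\big),$$ where $\beta_{det}^{\max}$ is the maximum of $\beta$ over the deterministic boxes and $\beta_{alg}^{\max}$ is its maximum over the non-signalling boxes; the same inequality holds if $\beta_{alg}^{\max}$ is the maximum over all boxes. The constant $c_0$ depends only on the numbers of outcomes $k,l_1,l_2$, not on $n$. -/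

import Mathlib

open scoped ComplexOrder Kronecker

noncomputable section

/-- A bipartite box `p(a,b|x,y)`: Alice has `n` inputs, input `x` having `k x` outcomes,
Bob has `m` inputs, input `y` having `l y` outcomes. -/
structure Box (n m : ℕ) (k : Fin n → ℕ) (l : Fin m → ℕ) where
  /-- `p x y a b` is the probability `p(a,b|x,y)`. -/
  p : (x : Fin n) → (y : Fin m) → Fin (k x) → Fin (l y) → ℝ
  nonneg : ∀ x y a b, 0 ≤ p x y a b
  sum_eq_one : ∀ x y, ∑ a, ∑ b, p x y a b = 1

/-- A state: a positive semidefinite matrix of trace one. -/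
def IsState {ι : Type} [Fintype ι] [DecidableEq ι] (ρ : Matrix ι ι ℂ) : Prop :=
  ρ.PosSemidef ∧ ρ.trace = 1

/-- A POVM with `r` outcomes: positive semidefinite matrices that sum to the identity. -/
def IsPOVM {ι : Type} [Fintype ι] [DecidableEq ι] {r : ℕ} (M : Fin r → Matrix ι ι ℂ) : Prop :=
  (∀ a, (M a).PosSemidef) ∧ ∑ a, M a = 1

namespace Box

variable {n m : ℕ} {k : Fin n → ℕ} {l : Fin m → ℕ}

/-- Non-signalling: Bob's marginals do not depend on Alice's input, and conversely. -/
def IsNonSignalling (P : Box n m k l) : Prop :=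
  (∀ (y : Fin m) (b : Fin (l y)) (x x' : Fin n), ∑ a, P.p x y a b = ∑ a, P.p x' y a b) ∧
  (∀ (x : Fin n) (a : Fin (k x)) (y y' : Fin m), ∑ b, P.p x y a b = ∑ b, P.p x y' a b)

/-- Deterministic: Alice's outcome is a function of her input, and Bob's of his. -/
def IsDeterministic (P : Box n m k l) : Prop :=
  ∃ (f : (x : Fin n) → Fin (k x)) (g : (y : Fin m) → Fin (l y)),
    ∀ x y a b, P.p x y a b = if a = f x ∧ b = g y then 1 else 0

/-- Quantum: `p(a,b|x,y) = tr ((M^x_a ⊗ N^y_b) ρ)` for POVMs `M^x` on `ℂ^dA`, `N^y` on `ℂ^dB`,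
and a shared state `ρ` on `ℂ^dA ⊗ ℂ^dB`, the dimensions being arbitrary. -/
def IsQuantum (P : Box n m k l) : Prop :=
  ∃ (dA dB : ℕ)
    (M : (x : Fin n) → Fin (k x) → Matrix (Fin dA) (Fin dA) ℂ)
    (N : (y : Fin m) → Fin (l y) → Matrix (Fin dB) (Fin dB) ℂ)
    (ρ : Matrix (Fin dA × Fin dB) (Fin dA × Fin dB) ℂ),
    (∀ x, IsPOVM (M x)) ∧ (∀ y, IsPOVM (N y)) ∧ IsState ρ ∧
    ∀ x y a b, ((P.p x y a b : ℝ) : ℂ) = ((M x a ⊗ₖ N y b) * ρ).trace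

/-- The weights `c ∈ [0,1]` for which `P = (1 - c) X + c D` with `X` a non-signalling box
and `D` a deterministic box. -/
def detWeights (P : Box n m k l) : Set ℝ :=
  {c | 0 ≤ c ∧ c ≤ 1 ∧ ∃ X D : Box n m k l, X.IsNonSignalling ∧ D.IsDeterministic ∧
    ∀ x y a b, P.p x y a b = (1 - c) * X.p x y a b + c * D.p x y a b}

/-- The fraction of determinism. -/
def fod (P : Box n m k l) : ℝ := sSup P.detWeights

/-- The value on the box `P` of the linear function with coefficients `s`. -/
def value (s : (x : Fin n) → (y : Fin m) → Fin (k x) → Fin (l y) → ℝ) (P : Box n m k l) : ℝ :=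
  ∑ x, ∑ y, ∑ a, ∑ b, s x y a b * P.p x y a b

/-- The maximal value of the linear function `s` over all boxes, signalling ones included. -/
def maxAll (s : (x : Fin n) → (y : Fin m) → Fin (k x) → Fin (l y) → ℝ) : ℝ :=
  sSup {v | ∃ Q : Box n m k l, v = value s Q}

/-- The maximal value of the linear function `s` over the non-signalling boxes. -/
def maxNS (s : (x : Fin n) → (y : Fin m) → Fin (k x) → Fin (l y) → ℝ) : ℝ :=
  sSup {v | ∃ Q : Box n m k l, Q.IsNonSignalling ∧ v = value s Q}

/-- The maximal value of the linear function `s` over the deterministic boxes. -/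
def maxDet (s : (x : Fin n) → (y : Fin m) → Fin (k x) → Fin (l y) → ℝ) : ℝ :=
  sSup {v | ∃ Q : Box n m k l, Q.IsDeterministic ∧ v = value s Q}

end Box

/-- The bound `0.1134 / (2 k l l₁ l₂)`, where `k` is the maximal number of Alice's outcomes,
`l₁` and `l₂` are the numbers of outcomes of Bob's two inputs, and `l = max l₁ l₂`. -/
def detBound {n : ℕ} (k : Fin n → ℕ) (l : Fin 2 → ℕ) : ℝ :=
  0.1134 / (2 * ((Finset.univ.sup k : ℕ) : ℝ) * ((max (l 0) (l 1) : ℕ) : ℝ) *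
    (l 0 : ℝ) * (l 1 : ℝ))

end

/-! A weight `c` is admissible once fixed outcomes `b`, `b'` of Bob's two inputs leave Alice, for
each `x`, an `a` with both `p(a,b|x,y)` and `p(a,b'|x,y')` at least `c`. By pigeonhole it is enough
that `∑ₐ min` of the two exceeds `k c`.

The symmetrised products `(N_b N'_b' + N'_b' N_b)/2` act as a joint measurement that need not be
positive. Their expectations `w b b'` sum to one, so by Cauchy–Schwarz some pair has `w²` large
against the sum of its marginals. For each `a`, Cauchy–Schwarz bounds the square of the `M^x_a` part
of `w` by `p(a,b|x,y) p(a,b'|x,y')`. Summing over `a` turns this into a lower bound on the overlap.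
Since `∑ₐ M^x_a = 1`, `w` and hence the choice of `b`, `b'` do not involve `x`, so `n` never enters.
-/

/-! ### Positive functionals and noncommuting effects -/

section PositiveFunctional

variable {ι κ : Type} [Fintype ι] [Fintype κ]

/-- An effect dominates its square. -/
theorem posSemidef_sub_mul_self [DecidableEq ι] {E : Matrix ι ι ℂ} (hE : E.PosSemidef)
    (hE' : (1 - E).PosSemidef) : (E - E * E).PosSemidef := by
  -- `E - E² = E(1-E)E + (1-E)E(1-E)`.
  have h₁ := hE'.conjTranspose_mul_mul_same E
  have h₂ := hE.conjTranspose_mul_mul_same (1 - E)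
  rw [hE.1.eq] at h₁
  rw [hE'.1.eq] at h₂
  have h := h₁.add h₂
  convert h using 1
  noncomm_ring

open scoped MatrixOrder Matrix.Norms.L2Operator in
theorem trace_mul_re_nonneg {A B : Matrix ι ι ℂ} (hA : A.PosSemidef) (hB : B.PosSemidef) :
    0 ≤ (A * B).trace.re := by
  classical
  obtain ⟨C, rfl⟩ := CStarAlgebra.nonneg_iff_eq_star_mul_self.mp hB.nonneg
  rw [Matrix.star_eq_conjTranspose]
  rw [← Matrix.mul_assoc, Matrix.trace_mul_comm, ← Matrix.mul_assoc]
  exact (Complex.le_def.1 (hA.mul_mul_conjTranspose_same C).trace_nonneg).1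

/-- The real functional `Y ↦ Re tr ((M ⊗ Y) ρ)`. -/
noncomputable def partialExpectation (ρ : Matrix (ι × κ) (ι × κ) ℂ) (M : Matrix ι ι ℂ) :
    Matrix κ κ ℂ →ₗ[ℝ] ℝ where
  toFun Y := ((M ⊗ₖ Y) * ρ).trace.re
  map_add' Y Z := by
    rw [Matrix.kronecker_add, Matrix.add_mul, Matrix.trace_add, Complex.add_re]
  map_smul' t Y := by
    rw [Matrix.kronecker_smul, Matrix.smul_mul, Matrix.trace_smul]
    simp

theorem partialExpectation_apply (ρ : Matrix (ι × κ) (ι × κ) ℂ) (M : Matrix ι ι ℂ)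
    (Y : Matrix κ κ ℂ) : partialExpectation ρ M Y = ((M ⊗ₖ Y) * ρ).trace.re := rfl

theorem sum_partialExpectation [DecidableEq ι] {r : ℕ} {M : Fin r → Matrix ι ι ℂ} (hM : IsPOVM M)
    (ρ : Matrix (ι × κ) (ι × κ) ℂ) (Y : Matrix κ κ ℂ) :
    ∑ a, partialExpectation ρ (M a) Y = partialExpectation ρ 1 Y := by
  have h : ∀ s : Finset (Fin r), (∑ a ∈ s, M a) ⊗ₖ Y = ∑ a ∈ s, M a ⊗ₖ Y := by
    intro s
    induction s using Finset.cons_induction with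
    | empty => simp
    | cons a s ha ih => rw [Finset.sum_cons, Finset.sum_cons, Matrix.add_kronecker, ih]
  simp only [partialExpectation_apply]
  rw [← Complex.re_sum, ← Matrix.trace_sum, ← Finset.sum_mul, ← h, hM.2]

theorem partialExpectation_nonneg {ρ : Matrix (ι × κ) (ι × κ) ℂ} (hρ : ρ.PosSemidef)
    {M : Matrix ι ι ℂ} (hM : M.PosSemidef) {Y : Matrix κ κ ℂ} (hY : Y.PosSemidef) :
    0 ≤ partialExpectation ρ M Y :=
  trace_mul_re_nonneg (hM.kronecker hY) hρ

theorem IsPOVM.one_sub_posSemidef [DecidableEq ι] {r : ℕ} {M : Fin r → Matrix ι ι ℂ} (hM : IsPOVM M)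
    (a : Fin r) : (1 - M a).PosSemidef := by
  rw [← hM.2, ← Finset.add_sum_erase _ _ (Finset.mem_univ a), add_sub_cancel_left]
  exact Matrix.posSemidef_sum _ fun i _ => hM.1 i

/-- The Cauchy–Schwarz inequality for the symmetrised product of two effects. -/
theorem partialExpectation_anticommutator_sq_le [DecidableEq κ] {ρ : Matrix (ι × κ) (ι × κ) ℂ}
    (hρ : ρ.PosSemidef) {M : Matrix ι ι ℂ} (hM : M.PosSemidef) {E F : Matrix κ κ ℂ}
    (hE : E.PosSemidef) (hE' : (1 - E).PosSemidef) (hF : F.PosSemidef)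
    (hF' : (1 - F).PosSemidef) :
    partialExpectation ρ M (E * F + F * E) ^ 2 ≤
      4 * (partialExpectation ρ M E * partialExpectation ρ M F) := by
  set φ := partialExpectation ρ M
  have hEE : φ (E * E) ≤ φ E := by
    have h := partialExpectation_nonneg hρ hM (posSemidef_sub_mul_self hE hE')
    rw [map_sub] at h
    exact sub_nonneg.1 h
  have hFF : φ (F * F) ≤ φ F := by
    have h := partialExpectation_nonneg hρ hM (posSemidef_sub_mul_self hF hF')
    rw [map_sub] at h
    exact sub_nonneg.1 h
  -- Expand `φ((E + tF)²) ≥ 0` and bound the squares of the effects by the effects; the discriminant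
  -- then gives the claim.
  have hquad : ∀ t : ℝ, 0 ≤ φ F * (t * t) + φ (E * F + F * E) * t + φ E := by
    intro t
    have hherm : (E + t • F).conjTranspose = E + t • F := by
      rw [Matrix.conjTranspose_add, Matrix.conjTranspose_smul, hE.1.eq, hF.1.eq, star_trivial]
    have h := partialExpectation_nonneg hρ hM
      (Matrix.posSemidef_conjTranspose_mul_self (E + t • F))
    have hexp : (E + t • F) * (E + t • F) = E * E + t • (E * F + F * E) + (t * t) • (F * F) := by
      rw [add_mul, mul_add, mul_add, smul_mul_assoc, smul_mul_assoc, mul_smul_comm,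
        mul_smul_comm, smul_smul, smul_add]
      abel
    rw [hherm, hexp, map_add, map_add, map_smul, map_smul, smul_eq_mul, smul_eq_mul] at h
    change 0 ≤ φ (E * E) + t * φ (E * F + F * E) + t * t * φ (F * F) at h
    have := mul_le_mul_of_nonneg_left hFF (mul_self_nonneg t)
    linarith
  have h := discrim_le_zero hquad
  rw [discrim] at h
  linarith

end PositiveFunctional

/-! ### Scalar inequalities -/

/-- The Bhattacharyya coefficient is controlled by the overlap `∑ min`. -/
theorem sum_sq_le_sum_min_mul {r : ℕ} {u s t : Fin r → ℝ} (hs : ∀ a, 0 ≤ s a)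
    (ht : ∀ a, 0 ≤ t a) (hu : ∀ a, u a ^ 2 ≤ s a * t a) :
    (∑ a, u a) ^ 2 ≤ (∑ a, min (s a) (t a)) * (∑ a, s a + ∑ a, t a) := by
  -- Cauchy–Schwarz is applied to `s t = min · max`, and `max ≤ s + t`.
  have hmax : ∑ a, max (s a) (t a) ≤ ∑ a, s a + ∑ a, t a := by
    rw [← Finset.sum_add_distrib]
    exact Finset.sum_le_sum fun a _ => max_le_add_of_nonneg (hs a) (ht a)
  refine (Finset.sum_sq_le_sum_mul_sum_of_sq_le_mul _ (fun a _ => le_min (hs a) (ht a))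
    (fun a _ => (hs a).trans (le_max_left _ _)) fun a _ => ?_).trans
    (mul_le_mul_of_nonneg_left hmax (Finset.sum_nonneg fun a _ => le_min (hs a) (ht a)))
  rw [min_mul_max]
  exact hu a

/-- Numbers `w b b'` of total sum one cannot all be small against `p b + q b'`. -/
theorem exists_lt_sq_of_sum_eq_one {r₁ r₂ : ℕ} {w : Fin r₁ → Fin r₂ → ℝ} {p : Fin r₁ → ℝ}
    {q : Fin r₂ → ℝ} (hw : ∑ b, ∑ b', w b b' = 1) (hp : ∀ b, 0 ≤ p b) (hq : ∀ b', 0 ≤ q b')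
    (hp₁ : ∑ b, p b = 1) (hq₁ : ∑ b', q b' = 1) {ε : ℝ} (hε : 0 ≤ ε)
    (hε₁ : ε * (2 * (max r₁ r₂ : ℕ) * r₁ * r₂) < 1) :
    ∃ b b', ε * (p b + q b') < w b b' ^ 2 := by
  by_contra! h
  -- The sum of `p b + q b'` over all pairs is `r₂ + r₁`, at most twice the maximum.
  have hcs : (∑ i : Fin r₁ × Fin r₂, w i.1 i.2) ^ 2 ≤
      (∑ _i : Fin r₁ × Fin r₂, ε) * ∑ i : Fin r₁ × Fin r₂, (p i.1 + q i.2) :=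
    Finset.sum_sq_le_sum_mul_sum_of_sq_le_mul _ (fun _ _ => hε)
      (fun i _ => add_nonneg (hp _) (hq _)) fun i _ => h i.1 i.2
  simp only [Fintype.sum_prod_type, hw, Finset.sum_add_distrib, hq₁, Finset.sum_const,
    Finset.card_univ, Fintype.card_prod, Fintype.card_fin, nsmul_eq_mul, Nat.cast_mul, ← Finset.mul_sum, hp₁, mul_one] at hcs
  have h₁ : (r₁ : ℝ) ≤ (max r₁ r₂ : ℕ) := by exact_mod_cast le_max_left _ _
  have h₂ : (r₂ : ℝ) ≤ (max r₁ r₂ : ℕ) := by exact_mod_cast le_max_right _ _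
  have h₃ : (r₁ * r₂ * ε : ℝ) * (r₂ + r₁) ≤ (r₁ * r₂ * ε : ℝ) * (2 * (max r₁ r₂ : ℕ)) :=
    mul_le_mul_of_nonneg_left (by linarith) (by positivity)
  linarith

namespace Box

/-! ### Deterministic weights and linear functions -/

section General

variable {n m : ℕ} {k : Fin n → ℕ} {l : Fin m → ℕ}

theorem IsDeterministic.isNonSignalling {D : Box n m k l} (hD : D.IsDeterministic) :
    D.IsNonSignalling := by
  obtain ⟨f, g, h⟩ := hD
  refine ⟨fun y b x x' => ?_, fun x a y y' => ?_⟩ <;> simp [h, ite_and]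

theorem p_le_one (P : Box n m k l) (x : Fin n) (y : Fin m) (a : Fin (k x)) (b : Fin (l y)) :
    P.p x y a b ≤ 1 := by
  rw [← P.sum_eq_one x y]
  exact (Finset.single_le_sum (f := fun b => P.p x y a b) (fun b _ => P.nonneg x y a b)
    (Finset.mem_univ b)).trans (Finset.single_le_sum (f := fun a => ∑ b, P.p x y a b)
    (fun a _ => Finset.sum_nonneg fun b _ => P.nonneg x y a b) (Finset.mem_univ a))

theorem outcomes_pos (P : Box n m k l) (x : Fin n) (y : Fin m) : 0 < k x ∧ 0 < l y := by
  have h := P.sum_eq_one x y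
  obtain ⟨a, -, ha⟩ := Finset.exists_ne_zero_of_sum_ne_zero (h ▸ one_ne_zero)
  obtain ⟨b, -, -⟩ := Finset.exists_ne_zero_of_sum_ne_zero ha
  exact ⟨a.pos, b.pos⟩

/-- The deterministic box with response functions `f` and `g`. -/
def deterministic (f : (x : Fin n) → Fin (k x)) (g : (y : Fin m) → Fin (l y)) : Box n m k l where
  p x y a b := if a = f x ∧ b = g y then 1 else 0
  nonneg x y a b := by split_ifs <;> norm_num
  sum_eq_one x y := by simp [ite_and]

theorem isDeterministic_deterministic (f : (x : Fin n) → Fin (k x))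
    (g : (y : Fin m) → Fin (l y)) : (deterministic f g).IsDeterministic :=
  ⟨f, g, fun _ _ _ _ => rfl⟩

/-- Equal total mass forces equality. This settles `c = 1`, where the remainder would divide by
zero. -/
theorem ext_of_le {P Q : Box n m k l} (h : ∀ x y a b, Q.p x y a b ≤ P.p x y a b)
    (x : Fin n) (y : Fin m) (a : Fin (k x)) (b : Fin (l y)) : P.p x y a b = Q.p x y a b := by
  have h₁ := (Finset.sum_eq_sum_iff_of_le
    fun a _ => Finset.sum_le_sum fun b _ => h x y a b).1
    ((Q.sum_eq_one x y).trans (P.sum_eq_one x y).symm) a (Finset.mem_univ a)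
  exact ((Finset.sum_eq_sum_iff_of_le fun b _ => h x y a b).1 h₁ b (Finset.mem_univ b)).symm

/-- The box left over when a deterministic part of weight `c < 1` is removed. -/
noncomputable def remainder (P D : Box n m k l) {c : ℝ} (hc : c < 1)
    (h : ∀ x y a b, c * D.p x y a b ≤ P.p x y a b) : Box n m k l where
  p x y a b := (P.p x y a b - c * D.p x y a b) / (1 - c)
  nonneg x y a b := div_nonneg (sub_nonneg.2 (h x y a b)) (sub_nonneg.2 hc.le)
  sum_eq_one x y := by
    simp only [← Finset.sum_div, Finset.sum_sub_distrib, ← Finset.mul_sum, P.sum_eq_one,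
      D.sum_eq_one, mul_one]
    exact div_self (sub_pos.2 hc).ne'

theorem IsNonSignalling.remainder {P D : Box n m k l} (hP : P.IsNonSignalling)
    (hD : D.IsNonSignalling) {c : ℝ} (hc : c < 1)
    (h : ∀ x y a b, c * D.p x y a b ≤ P.p x y a b) :
    (P.remainder D hc h).IsNonSignalling := by
  refine ⟨fun y b x x' => ?_, fun x a y y' => ?_⟩ <;>
    simp only [Box.remainder, ← Finset.sum_div, Finset.sum_sub_distrib, ← Finset.mul_sum]
  · rw [hP.1 y b x x', hD.1 y b x x']
  · rw [hP.2 x a y y', hD.2 x a y y']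

/-- A weight is admissible exactly when some deterministic strategy has at least that
probability for every pair of inputs. -/
theorem mem_detWeights_iff {P : Box n m k l} (hP : P.IsNonSignalling) (x₀ : Fin n) (y₀ : Fin m)
    {c : ℝ} : c ∈ P.detWeights ↔ 0 ≤ c ∧ ∃ (f : (x : Fin n) → Fin (k x))
      (g : (y : Fin m) → Fin (l y)), ∀ x y, c ≤ P.p x y (f x) (g y) := by
  constructor
  · rintro ⟨h₀, h₁, X, D, -, ⟨f, g, hD⟩, h⟩
    refine ⟨h₀, f, g, fun x y => ?_⟩
    have := mul_nonneg (sub_nonneg.2 h₁) (X.nonneg x y (f x) (g y))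
    rw [h, hD, if_pos ⟨rfl, rfl⟩]
    linarith
  · rintro ⟨h₀, f, g, h⟩
    have hle : ∀ x y a b, c * (deterministic f g).p x y a b ≤ P.p x y a b := by
      intro x y a b
      by_cases hab : a = f x ∧ b = g y
      · obtain ⟨rfl, rfl⟩ := hab
        simpa [deterministic] using h x y
      · simpa [deterministic, hab] using P.nonneg x y a b
    have hD := isDeterministic_deterministic f g
    have h₁ : c ≤ 1 := (h x₀ y₀).trans (P.p_le_one _ _ _ _)
    rcases h₁.lt_or_eq with hc | rfl
    · refine ⟨h₀, h₁, P.remainder _ hc hle, _, hP.remainder hD.isNonSignalling hc hle, hD, ?_⟩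
      intro x y a b
      rw [remainder, mul_div_cancel₀ _ (sub_pos.2 hc).ne', sub_add_cancel]
    · refine ⟨h₀, h₁, P, _, hP, hD, fun x y a b => ?_⟩
      rw [sub_self, zero_mul, zero_add, one_mul]
      exact ext_of_le (fun x y a b => by simpa using hle x y a b) x y a b

/-- The supremum is a maximum, over finitely many strategies, of the least probability over input
pairs. -/
theorem isGreatest_detWeights {P : Box n m k l} (hP : P.IsNonSignalling) (x₀ : Fin n)
    (y₀ : Fin m) : IsGreatest P.detWeights P.fod := by
  have hk : ∀ x, Nonempty (Fin (k x)) := fun x => ⟨⟨0, (P.outcomes_pos x y₀).1⟩⟩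
  have hl : ∀ y, Nonempty (Fin (l y)) := fun y => ⟨⟨0, (P.outcomes_pos x₀ y).2⟩⟩
  have hne : (Finset.univ : Finset (Fin n × Fin m)).Nonempty := ⟨(x₀, y₀), Finset.mem_univ _⟩
  obtain ⟨⟨f, g⟩, hfg⟩ := Finite.exists_max
    fun fg : ((x : Fin n) → Fin (k x)) × ((y : Fin m) → Fin (l y)) =>
      Finset.univ.inf' hne fun i : Fin n × Fin m => P.p i.1 i.2 (fg.1 i.1) (fg.2 i.2)
  have h : IsGreatest P.detWeights
      (Finset.univ.inf' hne fun i : Fin n × Fin m => P.p i.1 i.2 (f i.1) (g i.2)) := by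
    constructor
    · refine (mem_detWeights_iff hP x₀ y₀).2
        ⟨Finset.le_inf' _ _ fun i _ => P.nonneg _ _ _ _, f, g, fun x y => ?_⟩
      exact Finset.inf'_le (fun i : Fin n × Fin m => P.p i.1 i.2 (f i.1) (g i.2))
        (Finset.mem_univ (x, y))
    · intro c hc
      obtain ⟨-, f', g', hc⟩ := (mem_detWeights_iff hP x₀ y₀).1 hc
      exact (Finset.le_inf' _ _ fun i _ => hc i.1 i.2).trans (hfg (f', g'))
  rw [fod, h.csSup_eq]
  exact h

theorem value_le_sum_abs (s : (x : Fin n) → (y : Fin m) → Fin (k x) → Fin (l y) → ℝ)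
    (P : Box n m k l) : value s P ≤ ∑ x, ∑ y, ∑ a, ∑ b, |s x y a b| := by
  unfold value
  gcongr with x _ y _ a _ b
  calc s x y a b * P.p x y a b ≤ |s x y a b| * P.p x y a b :=
        mul_le_mul_of_nonneg_right (le_abs_self _) (P.nonneg _ _ _ _)
    _ ≤ |s x y a b| := mul_le_of_le_one_right (abs_nonneg _) (P.p_le_one _ _ _ _)

theorem value_convexCombination (s : (x : Fin n) → (y : Fin m) → Fin (k x) → Fin (l y) → ℝ)
    {P X D : Box n m k l} {c : ℝ}
    (h : ∀ x y a b, P.p x y a b = (1 - c) * X.p x y a b + c * D.p x y a b) :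
    value s P = (1 - c) * value s X + c * value s D := by
  simp only [value, h, Finset.mul_sum, ← Finset.sum_add_distrib]
  refine Finset.sum_congr rfl fun x _ => Finset.sum_congr rfl fun y _ =>
    Finset.sum_congr rfl fun a _ => Finset.sum_congr rfl fun b _ => ?_
  ring

theorem value_le_maxAll (s : (x : Fin n) → (y : Fin m) → Fin (k x) → Fin (l y) → ℝ)
    (P : Box n m k l) : value s P ≤ maxAll s :=
  le_csSup ⟨_, by rintro _ ⟨Q, rfl⟩; exact value_le_sum_abs s Q⟩ ⟨P, rfl⟩

theorem value_le_maxNS (s : (x : Fin n) → (y : Fin m) → Fin (k x) → Fin (l y) → ℝ)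
    {P : Box n m k l} (hP : P.IsNonSignalling) : value s P ≤ maxNS s :=
  le_csSup ⟨_, by rintro _ ⟨Q, -, rfl⟩; exact value_le_sum_abs s Q⟩ ⟨P, hP, rfl⟩

theorem value_le_maxDet (s : (x : Fin n) → (y : Fin m) → Fin (k x) → Fin (l y) → ℝ)
    {P : Box n m k l} (hP : P.IsDeterministic) : value s P ≤ maxDet s :=
  le_csSup ⟨_, by rintro _ ⟨Q, -, rfl⟩; exact value_le_sum_abs s Q⟩ ⟨P, hP, rfl⟩

theorem value_le_of_mem_detWeights (s : (x : Fin n) → (y : Fin m) → Fin (k x) → Fin (l y) → ℝ)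
    {P : Box n m k l} {c : ℝ} (hc : c ∈ P.detWeights) :
    value s P ≤ maxNS s - c * (maxNS s - maxDet s) ∧
      value s P ≤ maxAll s - c * (maxAll s - maxDet s) := by
  obtain ⟨h₀, h₁, X, D, hX, hD, h⟩ := hc
  rw [value_convexCombination s h]
  have hd := mul_le_mul_of_nonneg_left (value_le_maxDet s hD) h₀
  have hns := mul_le_mul_of_nonneg_left (value_le_maxNS s hX) (sub_nonneg.2 h₁)
  have hall := mul_le_mul_of_nonneg_left (value_le_maxAll s X) (sub_nonneg.2 h₁)
  constructor <;> linarith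

theorem p_eq_partialExpectation {dA dB : ℕ} {P : Box n m k l}
    {M : (x : Fin n) → Fin (k x) → Matrix (Fin dA) (Fin dA) ℂ}
    {N : (y : Fin m) → Fin (l y) → Matrix (Fin dB) (Fin dB) ℂ}
    {ρ : Matrix (Fin dA × Fin dB) (Fin dA × Fin dB) ℂ}
    (h : ∀ x y a b, ((P.p x y a b : ℝ) : ℂ) = ((M x a ⊗ₖ N y b) * ρ).trace)
    (x : Fin n) (y : Fin m) (a : Fin (k x)) (b : Fin (l y)) :
    P.p x y a b = partialExpectation ρ (M x a) (N y b) := by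
  rw [partialExpectation_apply, ← h, Complex.ofReal_re]

theorem IsQuantum.isNonSignalling {P : Box n m k l} (hP : P.IsQuantum) : P.IsNonSignalling := by
  obtain ⟨dA, dB, M, N, ρ, hM, hN, -, h⟩ := hP
  have hp := p_eq_partialExpectation h
  refine ⟨fun y b x x' => ?_, fun x a y y' => ?_⟩
  · simp only [hp, sum_partialExpectation (hM _)]
  · simp only [hp, ← map_sum, (hN _).2]

end General

/-! ### The quantum bound for two inputs -/

section TwoInputs

variable {n : ℕ} {k : Fin n → ℕ} {l : Fin 2 → ℕ}

/-- Bob has a pair of outcomes which, for each of Alice's inputs, overlap in a total weight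
bounded below independently of the number of Alice's inputs. -/
theorem IsQuantum.exists_overlap {P : Box n 2 k l} (hP : P.IsQuantum) {ε : ℝ} (hε : 0 ≤ ε)
    (hε₁ : ε * (2 * (max (l 0) (l 1) : ℕ) * l 0 * l 1) < 1) :
    ∃ (b : Fin (l 0)) (b' : Fin (l 1)), ∀ x,
      ε < ∑ a, min (P.p x 0 a b) (P.p x 1 a b') := by
  obtain ⟨dA, dB, M, N, ρ, hM, hN, hρ, h⟩ := hP
  have hp := p_eq_partialExpectation h
  have hone : partialExpectation ρ 1 (1 : Matrix (Fin dB) (Fin dB) ℂ) = 1 := by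
    rw [partialExpectation_apply, Matrix.one_kronecker_one, one_mul, hρ.2, Complex.one_re]
  have hnn : ∀ y b, 0 ≤ partialExpectation ρ 1 (N y b) := fun y b =>
    partialExpectation_nonneg hρ.1 Matrix.PosSemidef.one ((hN y).1 b)
  have hmarg : ∀ y, ∑ b, partialExpectation ρ 1 (N y b) = 1 := fun y => by
    rw [← map_sum, (hN y).2, hone]
  have hw : ∑ b, ∑ b', partialExpectation ρ 1 (N 0 b * N 1 b' + N 1 b' * N 0 b) / 2 = 1 := by
    simp only [← Finset.sum_div, ← map_sum, Finset.sum_add_distrib, ← Finset.mul_sum,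
      ← Finset.sum_mul, (hN _).2, mul_one, map_add, hone]
    norm_num
  obtain ⟨b, b', hb⟩ := exists_lt_sq_of_sum_eq_one hw (hnn 0) (hnn 1) (hmarg 0) (hmarg 1) hε hε₁
  refine ⟨b, b', fun x => ?_⟩
  have key := sum_sq_le_sum_min_mul
    (u := fun a => partialExpectation ρ (M x a) (N 0 b * N 1 b' + N 1 b' * N 0 b) / 2)
    (fun a => P.nonneg x 0 a b) (fun a => P.nonneg x 1 a b') fun a => by
      have := partialExpectation_anticommutator_sq_le hρ.1 ((hM x).1 a) ((hN 0).1 b)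
        ((hN 0).one_sub_posSemidef b) ((hN 1).1 b') ((hN 1).one_sub_posSemidef b')
      rw [hp, hp, div_pow]
      linarith
  rw [← Finset.sum_div, sum_partialExpectation (hM x),
    Finset.sum_congr rfl fun a _ => hp x 0 a b, Finset.sum_congr rfl fun a _ => hp x 1 a b',
    sum_partialExpectation (hM x), sum_partialExpectation (hM x)] at key
  exact lt_of_mul_lt_mul_right (hb.trans_le key) (add_nonneg (hnn 0 b) (hnn 1 b'))

theorem IsQuantum.detBound_mem_detWeights {P : Box n 2 k l} (hP : P.IsQuantum) (x₀ : Fin n) :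
    detBound k l ∈ P.detWeights := by
  have h₀ : (0 : ℝ) < l 0 := by exact_mod_cast (P.outcomes_pos x₀ 0).2
  have h₁ : (0 : ℝ) < l 1 := by exact_mod_cast (P.outcomes_pos x₀ 1).2
  have hL : (0 : ℝ) < (max (l 0) (l 1) : ℕ) :=
    h₀.trans_le (by exact_mod_cast le_max_left _ _)
  have hkK : ∀ x, (k x : ℝ) ≤ (Finset.univ.sup k : ℕ) := fun x => by
    exact_mod_cast Finset.le_sup (f := k) (Finset.mem_univ x)
  have hK : (0 : ℝ) < (Finset.univ.sup k : ℕ) :=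
    lt_of_lt_of_le (by exact_mod_cast (P.outcomes_pos x₀ 0).1) (hkK x₀)
  have hc : 0 ≤ detBound k l := by unfold detBound; positivity
  -- This `ε` cancels `k`, so the condition on it reads `0.1134 < 1`; any constant below one would
  -- do.
  obtain ⟨b, b', hb⟩ := hP.exists_overlap (ε := (Finset.univ.sup k : ℕ) * detBound k l)
    (mul_nonneg hK.le hc) (by unfold detBound; field_simp; norm_num)
  have hex : ∀ x, ∃ a, detBound k l ≤ min (P.p x 0 a b) (P.p x 1 a b') := by
    intro x
    by_contra! hlt
    have hsum := Finset.sum_le_sum fun a (_ : a ∈ Finset.univ) => (hlt a).le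
    rw [Finset.sum_const, Finset.card_univ, Fintype.card_fin, nsmul_eq_mul] at hsum
    exact absurd (hb x) (not_lt.2 (hsum.trans (mul_le_mul_of_nonneg_right (hkK x) hc)))
  choose f hf using hex
  refine (mem_detWeights_iff hP.isNonSignalling x₀ 0).2
    ⟨hc, f, Fin.cons b (Fin.cons b' finZeroElim), fun x y => ?_⟩
  fin_cases y
  · exact (hf x).trans (min_le_left _ _)
  · exact (hf x).trans (min_le_right _ _)

end TwoInputs

end Box

theorem theorem1 (n : ℕ) (hn : 0 < n) (k : Fin n → ℕ) (l : Fin 2 → ℕ)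
    (P : Box n 2 k l) (hP : P.IsQuantum) :
    IsGreatest P.detWeights P.fod ∧
    detBound k l ≤ P.fod ∧
    ∀ s : (x : Fin n) → (y : Fin 2) → Fin (k x) → Fin (l y) → ℝ,
      Box.value s P ≤ Box.maxNS s - detBound k l * (Box.maxNS s - Box.maxDet s) ∧
      Box.value s P ≤ Box.maxAll s - detBound k l * (Box.maxAll s - Box.maxDet s) := by
  have hmax := Box.isGreatest_detWeights hP.isNonSignalling ⟨0, hn⟩ 0
  have hmem := hP.detBound_mem_detWeights ⟨0, hn⟩
  exact ⟨hmax, hmax.2 hmem, fun s => Box.value_le_of_mem_detWeights s hmem⟩
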